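/- Let $\theta$ be an uncountable regular cardinal and let $H_\theta$ be the set of all sets whose transitive closure has cardinality $<\theta$. Let $\mathcal K\in H_\theta$ be a set of uncountable regular cardinals with $\omega_1\notin\mathcal K$, put $\lambda=\sup(\mathcal K)$, and assume $\theta\gg\lambda$, that is, $\mathscr P(\mathscr P(\lambda))\in H_\theta$. For a set $M$ and a set $x$ let $\mathrm{Hull}(M,x)=\{f(x): f\in M \text{ a function},\ x\in\mathrm{dom}(f)\}$. For a countable $M\prec H_\theta$ with $\lambda\in M$, the promise game $G_1(M,\mathcal K)$ between PI and PII is played as follows. Put $M_0=M$ and $\mathrm{Promise}_0=\emptyset$. In round $n<\omega$: - PI plays a regular cardinal $\lambda_n\in M_n$ with $\omega_1<\lambda_n<\lambda$ and $\lambda_n\notin\mathcal K$. - PII plays a pair $(\lambda_n,\beta_n)$ with $\beta_n\in\lambda_n$, and $\mathrm{Promise}_{n+1}=\mathrm{Promise}_n\cup\{(\lambda_n,\beta_n)\}$. (If there is no cardinal $\lambda_n$ that PI may play, these first two moves are skipped and $\mathrm{Promise}_{n+1}=\mathrm{Promise}_n$.) - PI plays a pair $(\kappa_n,\nu_n)$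 with $\kappa_n\in\mathcal K\cap M_n$ and $\nu_n\in\kappa_n$. - PII plays an ordinal $\xi_n\in\kappa_n\setminus\nu_n$ such that, for $M_{n+1}=\mathrm{Hull}(M_n,\xi_n)$, we have $M_{n+1}\cap\omega_1=M_n\cap\omega_1$ and $\sup(M_{n+1}\cap\kappa)\le\beta$ for every $(\kappa,\beta)\in\mathrm{Promise}_{n+1}$. PII loses in round $n$ if PII fails to make such moves; PII wins if and only if PII does not lose in any round (if $\mathcal K\cap M_n=\emptyset$ at some stage, the game ends there and PII has won). Then the set of countable $M\prec H_\theta$ with $\lambda\in M$ for which PII has a winning strategy in $G_1(M,\mathcal K)$ is a projective stationary subset of $[H_\theta]^\omega$: for every stationary $S\subseteq\omega_1$, the set of all such $M$ with $M\cap\omega_1\in S$ is stationary in $[H_\theta]^\omega$, i.e. meets every subset of $[H_\theta]^\omega$ that is cofinal under inclusion and closed under unions of increasing $\omega$-sequences. -/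

import Mathlib

universe u

namespace NambaGame

open FirstOrder Cardinal Ordinal

/-! ### Sets, cardinals and elementary submodels

The ambient universe of set theory is `ZFSet.{u}`; ordinals and cardinals of that universe are
von Neumann ordinals. -/

/-- `H_θ`: the sets whose transitive closure has cardinality `< θ`, i.e. those contained in some
transitive set of cardinality `< θ`. -/
def H (θ : Cardinal.{u}) : Set ZFSet.{u} :=
  {x | ∃ t : ZFSet.{u}, t.IsTransitive ∧ x ⊆ t ∧ t.card < θ}

/-- `omegaOne` is the first uncountable ordinal, as a set. -/
noncomputable def omegaOne : ZFSet.{u} :=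
  (ω₁ : Ordinal.{u}).toZFSet

/-- `x` is an (infinite) regular cardinal. -/
def IsRegularCardinal (x : ZFSet.{u}) : Prop :=
  ∃ c : Cardinal.{u}, c.IsRegular ∧ x = c.ord.toZFSet

/-- `x` is an uncountable regular cardinal. -/
def IsUncountableRegular (x : ZFSet.{u}) : Prop :=
  ∃ c : Cardinal.{u}, ℵ₀ < c ∧ c.IsRegular ∧ x = c.ord.toZFSet

/-- `x ≪ θ`: the double power set of `x` belongs to `H_θ`. -/
def MuchSmaller (x : ZFSet.{u}) (θ : Cardinal.{u}) : Prop :=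
  x.powerset.powerset ∈ H θ

/-- `f` is a function, i.e. a set of ordered pairs that is single valued. -/
def IsFunction (f : ZFSet.{u}) : Prop :=
  ∃ d c : ZFSet.{u}, ZFSet.IsFunc d c f

/-- `Hull(M, x) = { f(x) : f ∈ M a function, x ∈ dom f }`. -/
def hull (M : Set ZFSet.{u}) (x : ZFSet.{u}) : Set ZFSet.{u} :=
  {y | ∃ f ∈ M, IsFunction f ∧ ZFSet.pair x y ∈ f}

/-- The only symbol of the language of set theory is a binary relation symbol. -/
inductive SetRel : ℕ → Type
  | mem : SetRel 2

/-- The first-order language of set theory. -/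
def setLang : FirstOrder.Language.{0, 0} := ⟨fun _ => Empty, SetRel⟩

/-- Every class `A` of sets is a structure for the language of set theory, with the true
membership relation. -/
instance setStructure (A : Set ZFSet.{u}) : setLang.Structure A where
  funMap := fun f _ => Empty.elim f
  RelMap := fun r => match r with
    | .mem => fun v => (v 0 : ZFSet.{u}) ∈ (v 1 : ZFSet.{u})

/-- `M ≺ A`: `M ⊆ A` and the inclusion map is elementary. -/
def IsElementarySubmodel (M A : Set ZFSet.{u}) : Prop :=
  ∃ e : M ↪ₑ[setLang] A, ∀ x : M, (e x : ZFSet.{u}) = x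

/-! ### Stationary and projective stationary sets of countable sets -/

/-- `[X]^ω`: the set of countably infinite subsets of `X`. -/
def countableSubsets (X : Set ZFSet.{u}) : Set (Set ZFSet.{u}) :=
  {a | a ⊆ X ∧ a.Countable ∧ a.Infinite}

/-- `C` is a club in `[X]^ω`. -/
structure IsClubIn (X : Set ZFSet.{u}) (C : Set (Set ZFSet.{u})) : Prop where
  subset : C ⊆ countableSubsets X
  unbounded : ∀ a ∈ countableSubsets X, ∃ c ∈ C, a ⊆ c
  closed : ∀ c : ℕ → Set ZFSet.{u}, Monotone c → (∀ n, c n ∈ C) → (⋃ n, c n) ∈ C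

/-- `A` is a stationary subset of `[X]^ω`. -/
def IsStationaryIn (X : Set ZFSet.{u}) (A : Set (Set ZFSet.{u})) : Prop :=
  A ⊆ countableSubsets X ∧ ∀ C, IsClubIn X C → (A ∩ C).Nonempty

/-- `M ∩ ω₁ ∈ S`, for a set `S` of countable ordinals. -/
def TraceMem (M : Set ZFSet.{u}) (S : Set (Set.Iio (ω₁ : Ordinal.{u}))) : Prop :=
  ∃ δ ∈ S, M ∩ (omegaOne : ZFSet.{u}) = ((δ : Ordinal.{u}).toZFSet : Set ZFSet.{u})

/-- `A` is a projective stationary subset of `[X]^ω`. -/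
def IsProjectiveStationary (X : Set ZFSet.{u}) (A : Set (Set ZFSet.{u})) : Prop :=
  A ⊆ countableSubsets X ∧
    ∀ S : Set (Set.Iio (ω₁ : Ordinal.{u})), IsStationary S →
      IsStationaryIn X {M | M ∈ A ∧ TraceMem M S}

/-! ### The game -/

/-- The moves of one complete round. `promise` is the pair `(λ_n, β_n)` consisting of the cardinal
played by PI and the bound played by PII, or `none` if this half of the round was skipped. PI then
plays `(κ_n, ν_n)` and PII answers `ξ_n`. -/
structure Round where
  promise : Option (ZFSet.{u} × ZFSet.{u})
  kappa : ZFSet.{u}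
  nu : ZFSet.{u}
  xi : ZFSet.{u}

/-- The model `M_n` after the rounds in the list `h`. Here and below a list of rounds has the most
recent round at its head. -/
def model (M : Set ZFSet.{u}) : List Round.{u} → Set ZFSet.{u}
  | [] => M
  | r :: h => hull (model M h) r.xi

/-- `Promise_n`, the set of all pairs `(λ_i, β_i)` played in the rounds in the list `h`. -/
def promises (h : List Round.{u}) : Set (ZFSet.{u} × ZFSet.{u}) :=
  {p | ∃ r ∈ h, r.promise = some p}

/-- When the current model is `N`, PI may play the cardinal `l` in the first half of the round:
`l ∈ N` is a regular cardinal with `ω₁ < l < λ = sup K` and `l ∉ K`. -/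
def LegalCardinal (K : ZFSet.{u}) (N : Set ZFSet.{u}) (l : ZFSet.{u}) : Prop :=
  IsRegularCardinal l ∧ l ∈ N ∧ omegaOne ∈ l ∧ l ∈ (ZFSet.sUnion K) ∧ l ∉ K

/-- First half of PI's part of a round: PI plays a legal cardinal; only if there is none, this half
of the round is skipped. -/
def LegalFirst (K : ZFSet.{u}) (N : Set ZFSet.{u}) : Option ZFSet.{u} → Prop
  | some l => LegalCardinal K N l
  | none => ∀ l, ¬ LegalCardinal K N l

/-- Second half of PI's part of a round: `κ ∈ K ∩ N` and `ν ∈ κ`. -/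
def LegalSecond (K : ZFSet.{u}) (N : Set ZFSet.{u}) (kappa nu : ZFSet.{u}) : Prop :=
  kappa ∈ K ∧ kappa ∈ N ∧ nu ∈ kappa

/-- PII survives with the answer `ξ`, when the current model is `N` and the promises to be kept are
those in `P`: `ξ ∈ κ \ ν`, `Hull(N, ξ) ∩ ω₁ = N ∩ ω₁`, and `sup (Hull(N, ξ) ∩ l) ≤ β` for all
`(l, β) ∈ P`, that is `α ≤ β` (for von Neumann ordinals: `α ⊆ β`) for each
`α ∈ Hull(N, ξ) ∩ l`. -/
def LegalAnswer (N : Set ZFSet.{u}) (P : Set (ZFSet.{u} × ZFSet.{u}))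
    (kappa nu xi : ZFSet.{u}) : Prop :=
  xi ∈ kappa ∧ xi ∉ nu ∧
    hull N xi ∩ (omegaOne : ZFSet.{u}) = N ∩ (omegaOne : ZFSet.{u}) ∧
    ∀ l β : ZFSet.{u}, (l, β) ∈ P → ∀ α ∈ hull N xi, α ∈ l → α ⊆ β

/-- A strategy for PII: given the completed rounds and the moves of the current round, it returns
PII's next move. -/
structure Strategy where
  /-- The bound `β_n`, given the completed rounds and `λ_n`. -/
  bound : List Round.{u} → ZFSet.{u} → ZFSet.{u}
  /-- The ordinal `ξ_n`, given the completed rounds, `(λ_n, β_n)` and `(κ_n, ν_n)`. -/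
  answer : List Round.{u} → Option (ZFSet.{u} × ZFSet.{u}) → ZFSet.{u} → ZFSet.{u} → ZFSet.{u}

/-- The round that results when PI plays `l?` and `(κ, ν)` after the rounds `h` and PII follows
`σ`. -/
def Strategy.round (σ : Strategy.{u}) (h : List Round.{u}) (l? : Option ZFSet.{u})
    (kappa nu : ZFSet.{u}) : Round.{u} :=
  let p := l?.map fun l => (l, σ.bound h l)
  { promise := p, kappa := kappa, nu := nu, xi := σ.answer h p kappa nu }

/-- The finite runs, consisting of complete rounds, of the game for `(M, K)` in which PI obeys the
rules and PII follows `σ`. -/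
inductive IsRun (M : Set ZFSet.{u}) (K : ZFSet.{u}) (σ : Strategy.{u}) : List Round.{u} → Prop
  | start : IsRun M K σ []
  | step (h : List Round.{u}) (l? : Option ZFSet.{u}) (kappa nu : ZFSet.{u})
      (hrun : IsRun M K σ h) (hfirst : LegalFirst K (model M h) l?)
      (hsecond : LegalSecond K (model M h) kappa nu) :
      IsRun M K σ (σ.round h l? kappa nu :: h)

/-- `σ` is a winning strategy for PII in the game for `(M, K)`: following `σ`, PII does not lose in
any round, i.e. against all legal moves of PI the bound satisfies `β_n ∈ λ_n` and PII survives with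
the answer `ξ_n`, where also the promise made in the current round has to be kept. -/
def Strategy.IsWinning (σ : Strategy.{u}) (M : Set ZFSet.{u}) (K : ZFSet.{u}) : Prop :=
  ∀ h : List Round.{u}, IsRun M K σ h →
    (∀ l, LegalCardinal K (model M h) l → σ.bound h l ∈ l) ∧
    ∀ (l? : Option ZFSet.{u}) (kappa nu : ZFSet.{u}),
      LegalFirst K (model M h) l? → LegalSecond K (model M h) kappa nu →
        LegalAnswer (model M h) (promises (σ.round h l? kappa nu :: h)) kappa nu
          (σ.round h l? kappa nu).xi

/-- The set of countable `M ≺ H_θ` with `sup K ∈ M` such that PII has a winning strategy in the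
game for `(M, K)`. -/
def winningModels (θ : Cardinal.{u}) (K : ZFSet.{u}) : Set (Set ZFSet.{u}) :=
  {M | M.Countable ∧ IsElementarySubmodel M (H θ) ∧ (ZFSet.sUnion K) ∈ M ∧
    ∃ σ : Strategy.{u}, σ.IsWinning M K}

end NambaGame

/-! The second player wins from `M` once there is a tree of finite sequences that splits unboundedly
at every node for each available κ ∈ K, and along which no hull gains a countable ordinal: answers
are taken in the tree, and each promise is made by shrinking it. The tree and its shrinkings come
from one determinacy argument, `exists_isNambaTree_or_reachable`. Fix a regular uncountable μ ∉ K
and an open game in which the first player names the successor itself for κ < μ, but only a lower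
bound for κ > μ. If the first player cannot force a bad event, the safe nodes form a suitable
subtree. Otherwise the first player wins for each of at most μ many events. Since κ > μ is regular,
one answer exceeds all the bounds demanded, so a single function F plays against all these
strategies at once. For a countable starting set fewer than μ nodes are reachable along F, so the
ordinals below μ in their hulls are bounded, which refutes one of the events. With μ = l and the
events "the bound b < l is exceeded" this is `IsNambaTree.exists_bounded`. With μ = ω₁ and events
indexed by δ ∈ S, for unions of initial segments of an ω₁-chain of models, a closure point in S
refutes its own event: `exists_isNambaTree_of_chain`. -/

namespace NambaGame

open FirstOrder Cardinal Ordinal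

/-! ### Closure properties of `H θ` -/

section HTheta

variable {θ : Cardinal.{u}}

theorem subset_of_mem_H {x : ZFSet.{u}} (hx : x ∈ H θ) {y : ZFSet.{u}} (hy : y ∈ x) : y ∈ H θ := by
  obtain ⟨t, ht, hxt, htc⟩ := hx
  exact ⟨t, ht, ht.subset_of_mem (hxt hy), htc⟩

theorem sUnion_mem_H {x : ZFSet.{u}} (hx : x ∈ H θ) : x.sUnion ∈ H θ := by
  obtain ⟨t, ht, hxt, htc⟩ := hx
  refine ⟨t, ht, fun y hy => ?_, htc⟩
  obtain ⟨z, hz, hyz⟩ := ZFSet.mem_sUnion.1 hy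
  exact ht.mem_trans hyz (hxt hz)

theorem card_lt_of_mem_H {x : ZFSet.{u}} (hx : x ∈ H θ) : x.card < θ := by
  obtain ⟨t, _, hxt, htc⟩ := hx
  exact (ZFSet.card_mono hxt).trans_lt htc

/-- By regularity, fewer than θ transitive sets of size below θ have a union of size below θ; adding
`x` itself keeps it transitive. -/
theorem mem_H_of_subset (hθ : θ.IsRegular) {x : ZFSet.{u}} (hx : ∀ y ∈ x, y ∈ H θ)
    (hc : x.card < θ) : x ∈ H θ := by
  choose t ht hyt htc using fun y : Shrink.{u} x => hx ((equivShrink x).symm y) (by simp)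
  refine ⟨x ∪ ZFSet.iUnion t, ?_, fun z hz => ZFSet.mem_union.2 (.inl hz), ?_⟩
  · intro z hz w hw
    rw [ZFSet.mem_union] at hz ⊢
    right
    rcases hz with hz | hz
    · rw [ZFSet.mem_iUnion]
      refine ⟨equivShrink x ⟨z, hz⟩, hyt _ ?_⟩
      simpa using hw
    · exact (ZFSet.IsTransitive.iUnion ht).mem_trans hw hz
  · refine ZFSet.card_union_le.trans_lt (add_lt_of_lt hθ.aleph0_le hc ?_)
    have := ZFSet.lift_card_iUnion_le_sum_card.{u, u} (f := t)
    rw [Cardinal.lift_id] at this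
    exact this.trans_lt (sum_lt_of_isRegular hθ hc htc)

theorem insert_mem_H (hθ : θ.IsRegular) {x y : ZFSet.{u}} (hx : x ∈ H θ) (hy : y ∈ H θ) :
    insert x y ∈ H θ := by
  refine mem_H_of_subset hθ (fun z hz => ?_) (ZFSet.card_insert_le.trans_lt
    (add_lt_of_lt hθ.aleph0_le (card_lt_of_mem_H hy) (one_lt_aleph0.trans_le hθ.aleph0_le)))
  rcases ZFSet.mem_insert_iff.1 hz with rfl | hz
  exacts [hx, subset_of_mem_H hy hz]

theorem toZFSet_mem_H {a : Ordinal.{u}} (ha : a.card < θ) : a.toZFSet ∈ H θ :=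
  ⟨_, (ZFSet.isOrdinal_toZFSet a).isTransitive, subset_rfl, by rwa [Ordinal.card_toZFSet]⟩

theorem empty_mem_H (hθ : θ.IsRegular) : ∅ ∈ H θ := by
  simpa using toZFSet_mem_H (a := 0) (by simpa using hθ.pos)

theorem pair_mem_H (hθ : θ.IsRegular) {x y : ZFSet.{u}} (hx : x ∈ H θ) (hy : y ∈ H θ) :
    ZFSet.pair x y ∈ H θ := by
  have h0 := empty_mem_H hθ
  have hs : ∀ z ∈ H θ, ({z} : ZFSet) ∈ H θ := fun z hz => by
    have := insert_mem_H hθ hz h0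
    rwa [insert_empty_eq] at this
  exact insert_mem_H hθ (hs x hx) (hs _ (insert_mem_H hθ hx (hs y hy)))

/-! ### Functions coded as sets of pairs -/

/-- The function with domain `d` and values `F x`. -/
noncomputable def graph (F : ZFSet.{u} → ZFSet.{u}) (d : ZFSet.{u}) : ZFSet.{u} :=
  @ZFSet.map F (Classical.allZFSetDefinable _) d

theorem pair_mem_graph {F : ZFSet.{u} → ZFSet.{u}} {d x y : ZFSet.{u}} :
    ZFSet.pair x y ∈ graph F d ↔ x ∈ d ∧ F x = y := by
  rw [graph, @ZFSet.mem_map F (Classical.allZFSetDefinable _)]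
  constructor
  · rintro ⟨z, hz, h⟩
    obtain ⟨rfl, rfl⟩ := ZFSet.pair_inj.1 h
    exact ⟨hz, rfl⟩
  · rintro ⟨hx, rfl⟩
    exact ⟨x, hx, rfl⟩

theorem isFunction_graph (F : ZFSet.{u} → ZFSet.{u}) (d : ZFSet.{u}) : IsFunction (graph F d) :=
  ⟨d, @ZFSet.image F (Classical.allZFSetDefinable _) d,
    (@ZFSet.map_isFunc F (Classical.allZFSetDefinable _) _ _).2 fun z hz =>
      (@ZFSet.mem_image F (Classical.allZFSetDefinable _) _ _).2 ⟨z, hz, rfl⟩⟩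

theorem graph_mem_H (hθ : θ.IsRegular) {F : ZFSet.{u} → ZFSet.{u}} {d : ZFSet.{u}}
    (hd : d ∈ H θ) (hF : ∀ x ∈ d, F x ∈ H θ) : graph F d ∈ H θ := by
  refine mem_H_of_subset hθ (fun y hy => ?_) ?_
  · rw [graph, @ZFSet.mem_map F (Classical.allZFSetDefinable _)] at hy
    obtain ⟨z, hz, rfl⟩ := hy
    exact pair_mem_H hθ (subset_of_mem_H hd hz) (hF z hz)
  · exact (@ZFSet.card_image_le _ _ (_)).trans_lt (card_lt_of_mem_H hd)

/-- The value of `f` at `x`. -/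
noncomputable def value (f x : ZFSet.{u}) : ZFSet.{u} :=
  open Classical in if h : ∃ y, ZFSet.pair x y ∈ f then h.choose else ∅

theorem IsFunction.unique {f x y z : ZFSet.{u}} (hf : IsFunction f) (hy : ZFSet.pair x y ∈ f)
    (hz : ZFSet.pair x z ∈ f) : y = z := by
  obtain ⟨d, c, hsub, h⟩ := hf
  exact (h x (ZFSet.pair_mem_prod.1 (hsub hy)).1).unique hy hz

theorem IsFunction.value_eq {f x y : ZFSet.{u}} (hf : IsFunction f) (hy : ZFSet.pair x y ∈ f) :
    value f x = y := by
  have h : ∃ y, ZFSet.pair x y ∈ f := ⟨y, hy⟩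
  rw [value, dif_pos h]
  exact hf.unique h.choose_spec hy

/-- Pairs are Kuratowski pairs, so the double union of `f` contains its domain and range and can
replace the domain in definitions. -/
theorem mem_sUnion_sUnion_of_pair_mem {f x y : ZFSet.{u}} (h : ZFSet.pair x y ∈ f) :
    x ∈ f.sUnion.sUnion ∧ y ∈ f.sUnion.sUnion := by
  have h2 : ({x, y} : ZFSet) ∈ f.sUnion := ZFSet.mem_sUnion_of_mem (by simp [ZFSet.pair]) h
  exact ⟨ZFSet.mem_sUnion_of_mem (by simp) h2, ZFSet.mem_sUnion_of_mem (by simp) h2⟩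

theorem value_mem_H (hθ : θ.IsRegular) {f : ZFSet.{u}} (hf : f ∈ H θ) (x : ZFSet.{u}) :
    value f x ∈ H θ := by
  rw [value]
  split_ifs with h
  · exact subset_of_mem_H (sUnion_mem_H (sUnion_mem_H hf))
      (mem_sUnion_sUnion_of_pair_mem h.choose_spec).2
  · exact empty_mem_H hθ

end HTheta

/-! ### Hulls of sets closed under pointwise operations -/

/-- `pointwiseConst 0 κ x` is the constant function on `κ` with value `x`, and
`pointwiseConst (n + 1)` is `pointwiseConst n` applied pointwise to two functions. -/
noncomputable def pointwiseConst : ℕ → ZFSet.{u} → ZFSet.{u} → ZFSet.{u}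
  | 0 => fun κ x => graph (fun _ => x) κ
  | n + 1 => fun f g =>
      graph (fun x => pointwiseConst n (value f x) (value g x)) f.sUnion.sUnion

theorem pointwiseConst_mem_H {θ : Cardinal.{u}} (hθ : θ.IsRegular) (n : ℕ) :
    ∀ {x y : ZFSet.{u}}, x ∈ H θ → y ∈ H θ → pointwiseConst n x y ∈ H θ := by
  induction n with
  | zero => exact fun hx hy => graph_mem_H hθ hx fun _ _ => hy
  | succ n ih =>
    exact fun hx hy => graph_mem_H hθ (sUnion_mem_H (sUnion_mem_H hx)) fun z _ =>
      ih (value_mem_H hθ hx z) (value_mem_H hθ hy z)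

/-- `N` is closed under all `pointwiseConst n`. -/
def IsConstClosed (N : Set ZFSet.{u}) : Prop :=
  ∀ n, ∀ x ∈ N, ∀ y ∈ N, pointwiseConst n x y ∈ N

/-- Operation `n` on values at `ξ` is the value at `ξ` of operation `n + 1` on the functions. Hence
the whole hierarchy survives hulls, whereas closure under constant functions alone, which is what
makes hulls increase, need not. -/
theorem IsConstClosed.hull {N : Set ZFSet.{u}} (hN : IsConstClosed N) (ξ : ZFSet.{u}) :
    IsConstClosed (hull N ξ) := by
  rintro n x ⟨f, hf, hff, hx⟩ y ⟨g, hg, hgf, hy⟩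
  refine ⟨_, hN (n + 1) f hf g hg, isFunction_graph _ _, pair_mem_graph.2 ⟨?_, ?_⟩⟩
  · exact (mem_sUnion_sUnion_of_pair_mem hx).1
  · simp only [hff.value_eq hx, hgf.value_eq hy]

theorem IsConstClosed.subset_hull {N : Set ZFSet.{u}} (hN : IsConstClosed N) {κ ξ : ZFSet.{u}}
    (hκ : κ ∈ N) (hξ : ξ ∈ κ) : N ⊆ NambaGame.hull N ξ := fun x hx =>
  ⟨_, hN 0 κ hκ x hx, isFunction_graph _ _, pair_mem_graph.2 ⟨hξ, rfl⟩⟩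

theorem hull_mono {M N : Set ZFSet.{u}} (h : M ⊆ N) (ξ : ZFSet.{u}) : hull M ξ ⊆ hull N ξ := by
  rintro x ⟨f, hf, hx⟩
  exact ⟨f, h hf, hx⟩

theorem countable_hull {N : Set ZFSet.{u}} (hN : N.Countable) (ξ : ZFSet.{u}) :
    (hull N ξ).Countable := by
  refine (hN.image fun f => value f ξ).mono ?_
  rintro x ⟨f, hf, hff, hx⟩
  exact ⟨f, hf, hff.value_eq hx⟩

/-! ### Iterated hulls -/

/-- The hull of `M` after adding the elements of the list, the last one first. -/
def iterHull (M : Set ZFSet.{u}) : List ZFSet.{u} → Set ZFSet.{u}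
  | [] => M
  | ξ :: s => hull (iterHull M s) ξ

theorem countable_iterHull {M : Set ZFSet.{u}} (hM : M.Countable) :
    ∀ s, (iterHull M s).Countable
  | [] => hM
  | ξ :: s => countable_hull (countable_iterHull hM s) ξ

theorem iterHull_mono {M N : Set ZFSet.{u}} (h : M ⊆ N) : ∀ s, iterHull M s ⊆ iterHull N s
  | [] => h
  | ξ :: s => hull_mono (iterHull_mono h s) ξ

/-- Each hull step uses one function, so an element traces back to a single member of the base set;
no directedness is needed. -/
theorem exists_mem_iterHull_of_mem_iUnion {ι : Type*} {D : ι → Set ZFSet.{u}} {x : ZFSet.{u}} :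
    ∀ {s}, x ∈ iterHull (⋃ i, D i) s → ∃ i, x ∈ iterHull (D i) s
  | [], h => Set.mem_iUnion.1 h
  | _ :: _, ⟨f, hf, hx⟩ =>
    let ⟨i, hi⟩ := exists_mem_iterHull_of_mem_iUnion hf
    ⟨i, f, hi, hx⟩

theorem model_eq_iterHull (M : Set ZFSet.{u}) : ∀ h, model M h = iterHull M (h.map Round.xi)
  | [] => rfl
  | r :: h => by rw [model, model_eq_iterHull M h]; rfl

/-! ### Namba trees -/

theorem exists_toZFSet_bound {c : Cardinal.{u}} (hc : c.IsRegular) {X : Type*}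
    (hX : HasCardinalLT X c) (f : X → Ordinal.{u}) (hf : ∀ x, f x < c.ord) :
    ∃ b < c.ord, ∀ x, f x ≤ b := by
  have := hX.small
  refine ⟨⨆ y, f ((equivShrink.{u} X).symm y),
    Ordinal.iSup_lt_of_lt_cof ?_ fun y => hf _, fun x => ?_⟩
  · rw [hc.cof_ord, ← hasCardinalLT_iff_cardinal_mk_lt]
    exact (hasCardinalLT_iff_of_equiv (equivShrink X) c).1 hX
  · have := Ordinal.le_iSup (fun y => f ((equivShrink.{u} X).symm y)) (equivShrink X x)
    simpa using this

/-- The nodes of a tree are finite sequences, with the last element at the head. At the node `s`,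
the cardinals in `A s` are available, and for each of them that belongs to `K` the node has
unboundedly many successors in `T`. -/
def IsNambaTree (K : ZFSet.{u}) (A : List ZFSet.{u} → Set ZFSet.{u})
    (T : Set (List ZFSet.{u})) : Prop :=
  ∀ s ∈ T, ∀ κ ∈ K, κ ∈ A s → ∀ ν ∈ κ, ∃ ξ ∈ κ, ξ ∉ ν ∧ ξ :: s ∈ T

/-- The first player can force the play from `s` into `Bad`, as witnessed by the ordinal `α`. For
cardinals `κ < μ` the first player chooses the successor in `T`, for `κ > μ` only a lower bound. -/
inductive ForcesBad (K : ZFSet.{u}) (μ : Cardinal.{u}) (A : List ZFSet.{u} → Set ZFSet.{u})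
    (T : Set (List ZFSet.{u})) (Bad : List ZFSet.{u} → Prop) :
    Ordinal.{u} → List ZFSet.{u} → Prop
  | bad {α s} : Bad s → ForcesBad K μ A T Bad α s
  | small {α α' s κ ξ} : κ ∈ K → κ ∈ A s → κ.card < μ → ξ ∈ κ → ξ :: s ∈ T → α' < α →
      ForcesBad K μ A T Bad α' (ξ :: s) → ForcesBad K μ A T Bad α s
  | large {α s κ ν} (g : ZFSet.{u} → Ordinal.{u}) : κ ∈ K → κ ∈ A s → μ < κ.card → ν ∈ κ →
      (∀ ξ ∈ κ, ξ ∉ ν → ξ :: s ∈ T → g ξ < α) →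
      (∀ ξ ∈ κ, ξ ∉ ν → ξ :: s ∈ T → ForcesBad K μ A T Bad (g ξ) (ξ :: s)) →
      ForcesBad K μ A T Bad α s

/-- The nodes that can be reached from `s₀` when the first player chooses the successor for
cardinals `κ < μ`, and the successor is given by the function `F` for `κ > μ`. -/
inductive Reachable (K : ZFSet.{u}) (μ : Cardinal.{u}) (A : List ZFSet.{u} → Set ZFSet.{u})
    (T : Set (List ZFSet.{u})) (F : List ZFSet.{u} → ZFSet.{u} → ZFSet.{u})
    (s₀ : List ZFSet.{u}) : List ZFSet.{u} → Prop
  | root : Reachable K μ A T F s₀ s₀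
  | small {s κ ξ} : Reachable K μ A T F s₀ s → κ ∈ K → κ ∈ A s → κ.card < μ → ξ ∈ κ →
      ξ :: s ∈ T → Reachable K μ A T F s₀ (ξ :: s)
  | large {s κ} : Reachable K μ A T F s₀ s → κ ∈ K → κ ∈ A s → μ < κ.card →
      Reachable K μ A T F s₀ (F s κ :: s)

/-! ### Determinacy and the size of the set of reachable nodes -/

section Determinacy

variable {K : ZFSet.{u}} {μ : Cardinal.{u}} {T : Set (List ZFSet.{u})}

/-- From a safe node every successor for κ < μ is safe, as the first player could have chosen it.
For κ > μ, if no safe successor lay outside ν, playing ν would win. -/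
theorem isNambaTree_not_forcesBad {A : List ZFSet.{u} → Set ZFSet.{u}}
    {Bad : List ZFSet.{u} → Prop} (hμ : ∀ κ ∈ K, κ.card ≠ μ) (hT : IsNambaTree K A T) :
    IsNambaTree K A {s ∈ T | ∀ α, ¬ ForcesBad K μ A T Bad α s} := by
  rintro s ⟨hs, hs'⟩ κ hκ hκA ν hν
  rcases lt_or_gt_of_ne (hμ κ hκ) with h | h
  · obtain ⟨ξ, hξ, hξν, hξT⟩ := hT s hs κ hκ hκA ν hν
    exact ⟨ξ, hξ, hξν, hξT, fun α hα =>
      hs' (α + 1) (.small hκ hκA h hξ hξT (lt_add_one α) hα)⟩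
  · by_contra! hcon
    have hex : ∀ ξ, ξ ∈ κ → ξ ∉ ν → ξ :: s ∈ T → ∃ α, ForcesBad K μ A T Bad α (ξ :: s) := by
      intro ξ h1 h2 h3
      by_contra! h4
      exact hcon ξ h1 h2 ⟨h3, h4⟩
    have hex' : ∀ ξ, ∃ α, ξ ∈ κ → ξ ∉ ν → ξ :: s ∈ T → ForcesBad K μ A T Bad α (ξ :: s) := by
      intro ξ
      by_cases h5 : ξ ∈ κ ∧ ξ ∉ ν ∧ ξ :: s ∈ T
      · obtain ⟨α, hα⟩ := hex ξ h5.1 h5.2.1 h5.2.2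
        exact ⟨α, fun _ _ _ => hα⟩
      · exact ⟨0, fun h6 h7 h8 => absurd ⟨h6, h7, h8⟩ h5⟩
    choose g hg using hex'
    -- The supremum exists because κ is a set; irrelevant values of `g` can only enlarge it.
    refine hs' (⨆ ξ : κ, (g ξ + 1)) (.large g hκ hκA h hν (fun ξ h1 _ _ => ?_) hg)
    exact (lt_add_one _).trans_le
      (le_ciSup (f := fun ξ : κ => g ξ + 1) Ordinal.bddAbove_of_small ⟨ξ, h1⟩)

/-- Simultaneous determinacy: if for each `b` the first player can force the play into `Bad b`, then
the second player can answer for cardinals `κ > μ` by a single function `F` in such a way that for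
each `b` there is a play according to `F` that ends in `Bad b`. -/
theorem exists_isNambaTree_or_reachable {B : Type*} (hB : HasCardinalLT B (Order.succ μ))
    (hK : ∀ κ ∈ K, ∃ c : Cardinal.{u}, c.IsRegular ∧ κ = c.ord.toZFSet ∧ c ≠ μ)
    {A : B → List ZFSet.{u} → Set ZFSet.{u}} (hT : ∀ b, IsNambaTree K (A b) T)
    (Bad : B → List ZFSet.{u} → Prop) {s₀ : List ZFSet.{u}} (hs₀ : s₀ ∈ T) :
    (∃ b, ∃ T' ⊆ T, s₀ ∈ T' ∧ IsNambaTree K (A b) T' ∧ ∀ s ∈ T', ¬ Bad b s) ∨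
      ∃ F, ∀ b, ∃ s, Reachable K μ (A b) T F s₀ s ∧ Bad b s := by
  have hμ : ∀ κ ∈ K, κ.card ≠ μ := by
    intro κ hκ
    obtain ⟨c, -, rfl, hc⟩ := hK κ hκ
    simpa using hc
  by_cases hlose : ∃ b, ∀ α, ¬ ForcesBad K μ (A b) T (Bad b) α s₀
  · obtain ⟨b, hb⟩ := hlose
    exact .inl ⟨b, _, fun _ hs => hs.1, And.intro hs₀ hb, isNambaTree_not_forcesBad hμ (hT b),
      fun s hs h => hs.2 0 (.bad h)⟩
  push Not at hlose
  right
  -- the least rank of a win of the first player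
  let r : B → List ZFSet.{u} → Ordinal.{u} := fun b s =>
    sInf {α | ForcesBad K μ (A b) T (Bad b) α s}
  -- `P b s κ ν`: after the bound ν, every answer lowers the rank for `b`.
  let P : B → List ZFSet.{u} → ZFSet.{u} → ZFSet.{u} → Prop := fun b s κ ν =>
    ∀ ξ ∈ κ, ξ ∉ ν → ξ :: s ∈ T → ∃ α < r b s, ForcesBad K μ (A b) T (Bad b) α (ξ :: s)
  have hF : ∀ s κ, ∃ ξ, s ∈ T → κ ∈ K → μ < κ.card → (∃ b, κ ∈ A b s) →
      ξ ∈ κ ∧ ξ :: s ∈ T ∧ ∀ b, (∃ ν ∈ κ, P b s κ ν) →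
        ∃ ν ∈ κ, P b s κ ν ∧ ξ ∉ ν := by
    intro s κ
    by_cases h : s ∈ T ∧ κ ∈ K ∧ μ < κ.card ∧ ∃ b, κ ∈ A b s
    swap
    · exact ⟨∅, fun h1 h2 h3 h4 => absurd ⟨h1, h2, h3, h4⟩ h⟩
    obtain ⟨hs, hκ, hμκ, b₀, hb₀⟩ := h
    obtain ⟨c, hc, rfl, -⟩ := hK κ hκ
    have h1 : ∀ b, ∃ a < c.ord, (∃ ν ∈ c.ord.toZFSet, P b s c.ord.toZFSet ν) →
        P b s c.ord.toZFSet a.toZFSet := by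
      intro b
      by_cases h : ∃ ν ∈ c.ord.toZFSet, P b s c.ord.toZFSet ν
      · obtain ⟨ν, hν, hP⟩ := h
        obtain ⟨a, ha, rfl⟩ := mem_toZFSet_iff.1 hν
        exact ⟨a, ha, fun _ => hP⟩
      · exact ⟨0, hc.ord_pos, fun h' => absurd h' h⟩
    choose a ha haP using h1
    -- At most μ < c bounds, one for each `b`, have a common bound below the regular cardinal c.
    obtain ⟨d, hd, had⟩ := exists_toZFSet_bound hc
      (hB.of_le (Order.succ_le_of_lt (by simpa using hμκ))) a ha
    -- The tree `T` is common to all `b`, so the splitting for one `b₀` provides an answer for all.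
    obtain ⟨ξ, hξ, hξd, hξT⟩ := hT b₀ s hs _ hκ hb₀ d.toZFSet (toZFSet_mem_toZFSet_iff.2 hd)
    refine ⟨ξ, fun _ _ _ _ => ⟨hξ, hξT, fun b hb => ⟨(a b).toZFSet,
      toZFSet_mem_toZFSet_iff.2 (ha b), haP b hb, fun h => hξd ?_⟩⟩⟩
    exact toZFSet_subset_toZFSet_iff.2 (had b) h
  choose F hF using hF
  refine ⟨F, fun b => ?_⟩
  have key : ∀ α s, s ∈ T → Reachable K μ (A b) T F s₀ s → ForcesBad K μ (A b) T (Bad b) α s →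
      ∃ t, Reachable K μ (A b) T F s₀ t ∧ Bad b t := by
    intro α
    induction α using WellFoundedLT.induction with
    | ind α ih =>
      intro s hs hR hα
      -- `F` was chosen against the least rank, so the win analysed must be one of least rank, not
      -- the given one.
      have hr : ForcesBad K μ (A b) T (Bad b) (r b s) s :=
        csInf_mem (s := {α | ForcesBad K μ (A b) T (Bad b) α s}) ⟨α, hα⟩
      have hrα : r b s ≤ α := csInf_le' (s := {α | ForcesBad K μ (A b) T (Bad b) α s}) hα
      generalize hρ : r b s = ρ at hr
      cases hr with
      | bad h => exact ⟨s, hR, h⟩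
      | small hκ hκA hκμ hξ hξT hlt h =>
        exact ih _ (hlt.trans_le (hρ ▸ hrα)) _ hξT (.small hR hκ hκA hκμ hξ hξT) h
      | @large _ _ κ ν g hκ hκA hκμ hν hg h =>
        obtain ⟨hFκ, hFT, hFb⟩ := hF s κ hs hκ hκμ ⟨b, hκA⟩
        obtain ⟨ν', hν', hP, hFν'⟩ := hFb b ⟨ν, hν, fun ξ h1 h2 h3 =>
          ⟨g ξ, by rw [hρ]; exact hg ξ h1 h2 h3, h ξ h1 h2 h3⟩⟩
        obtain ⟨α', hα', hlose'⟩ := hP _ hFκ hFν' hFT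
        exact ih α' (hα'.trans_le hrα) _ hFT (.large hR hκ hκA hκμ) hlose'
  obtain ⟨α, hα⟩ := hlose b
  exact key α s₀ hs₀ .root hα

theorem hasCardinalLT_of_countable {X : Type*} [Countable X] {c : Cardinal.{u}} (hc : ℵ₀ < c) :
    HasCardinalLT X c := by
  refine lt_of_le_of_lt (b := ℵ₀) ?_ ?_
  · rw [Cardinal.lift_le_aleph0]; exact Cardinal.mk_le_aleph0
  · rwa [Cardinal.aleph0_lt_lift]

/-- A node has countably many available κ; each contributes one successor through `F` and, if κ < μ,
fewer than μ others. Regularity of μ bounds each level, and then the union of the ω levels. -/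
theorem hasCardinalLT_reachable (hμ : μ.IsRegular) (hμ' : ℵ₀ < μ)
    {A : List ZFSet.{u} → Set ZFSet.{u}} (hA : ∀ s, (A s).Countable)
    (F : List ZFSet.{u} → ZFSet.{u} → ZFSet.{u}) (s₀ : List ZFSet.{u}) :
    HasCardinalLT {s | Reachable K μ A T F s₀ s} μ := by
  have : Fact μ.IsRegular := ⟨hμ⟩
  let succs : List ZFSet.{u} → Set (List ZFSet.{u}) := fun s =>
    ⋃ κ : A s, ({F s κ :: s} ∪ ⋃ _ : PLift (κ.1.card < μ), (fun ξ => ξ :: s) '' (κ.1 : Set ZFSet))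
  have hsuccs : ∀ s, HasCardinalLT (succs s) μ := by
    intro s
    have := (hA s).to_subtype
    refine hasCardinalLT_iUnion _ (hasCardinalLT_of_countable hμ') fun κ => ?_
    refine hasCardinalLT_union hμ.aleph0_le (hasCardinalLT_of_countable hμ') ?_
    refine hasCardinalLT_iUnion _ (hasCardinalLT_of_countable hμ') fun h => ?_
    have hκ : HasCardinalLT (κ.1 : Set ZFSet) μ := by
      rw [HasCardinalLT]
      have := ZFSet.cardinalMk_coe_sort (x := κ.1)
      rw [show #(κ.1 : Set ZFSet.{u}) = Cardinal.lift.{u + 1} κ.1.card from this]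
      simpa using h.down
    exact hκ.of_surjective (fun ξ => ⟨ξ.1 :: s, ξ.1, ξ.2, rfl⟩) (by
      rintro ⟨_, ξ, hξ, rfl⟩
      exact ⟨⟨ξ, hξ⟩, rfl⟩)
  let L : ℕ → Set (List ZFSet.{u}) := fun n => n.rec {s₀} fun _ l => ⋃ s : l, succs s
  have hL : ∀ n, HasCardinalLT ↥(L n) μ := by
    intro n
    induction n with
    | zero => exact hasCardinalLT_of_countable (X := ({s₀} : Set _)) hμ'
    | succ n ih => exact hasCardinalLT_iUnion _ ih fun s => hsuccs s
  have hsub : {s | Reachable K μ A T F s₀ s} ⊆ ⋃ n, L n := by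
    intro s hs
    induction hs with
    | root => exact Set.mem_iUnion.2 ⟨0, rfl⟩
    | @small s κ ξ _ _ hκA hκμ hξ _ ih =>
      obtain ⟨n, hn⟩ := Set.mem_iUnion.1 ih
      refine Set.mem_iUnion.2 ⟨n + 1, Set.mem_iUnion.2 ⟨⟨s, hn⟩, Set.mem_iUnion.2 ⟨⟨κ, hκA⟩, ?_⟩⟩⟩
      exact .inr (Set.mem_iUnion.2 ⟨⟨hκμ⟩, ξ, hξ, rfl⟩)
    | @large s κ _ _ hκA _ ih =>
      obtain ⟨n, hn⟩ := Set.mem_iUnion.1 ih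
      refine Set.mem_iUnion.2 ⟨n + 1, Set.mem_iUnion.2 ⟨⟨s, hn⟩, Set.mem_iUnion.2 ⟨⟨κ, hκA⟩, ?_⟩⟩⟩
      exact .inl rfl
  exact (hasCardinalLT_iUnion L (hasCardinalLT_of_countable hμ') hL).of_injective
    (Set.inclusion hsub) (Set.inclusion_injective hsub)

end Determinacy

/-! ### Shrinking a tree to keep a promise -/

theorem hasCardinalLT_Iio_ord (c : Cardinal.{u}) :
    HasCardinalLT (Set.Iio c.ord) (Order.succ c) := by
  rw [HasCardinalLT, Cardinal.mk_Iio_ordinal]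
  simp

/-- A Namba tree for a countable set can be shrunk in such a way that the suprema of the models
below the regular cardinal `l ∉ K` become bounded. -/
theorem IsNambaTree.exists_bounded {K : ZFSet.{u}} (hK : ∀ κ ∈ K, IsUncountableRegular κ)
    {M : Set ZFSet.{u}} (hM : M.Countable) {T : Set (List ZFSet.{u})}
    (hT : IsNambaTree K (iterHull M) T) {s₀ : List ZFSet.{u}} (hs₀ : s₀ ∈ T) {c : Cardinal.{u}}
    (hc : c.IsRegular) (hc' : ℵ₀ < c) (hcK : c.ord.toZFSet ∉ K) :
    ∃ β ∈ c.ord.toZFSet, ∃ T' ⊆ T, s₀ ∈ T' ∧ IsNambaTree K (iterHull M) T' ∧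
      ∀ s ∈ T', ∀ α ∈ iterHull M s, α ∈ c.ord.toZFSet → α ⊆ β := by
  have hK' : ∀ κ ∈ K, ∃ d : Cardinal.{u}, d.IsRegular ∧ κ = d.ord.toZFSet ∧ d ≠ c := by
    intro κ hκ
    obtain ⟨d, -, hd, rfl⟩ := hK κ hκ
    exact ⟨d, hd, rfl, by rintro rfl; exact hcK hκ⟩
  rcases exists_isNambaTree_or_reachable (hasCardinalLT_Iio_ord c) hK'
    (A := fun _ => iterHull M) (fun _ => hT)
    (fun b s => ∃ α ∈ iterHull M s, α ∈ c.ord.toZFSet ∧ ¬ α ⊆ b.1.toZFSet) hs₀ with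
    ⟨b, T', hT'T, hs, hT', hbad⟩ | ⟨F, hF⟩
  · refine ⟨b.1.toZFSet, toZFSet_mem_toZFSet_iff.2 b.2, T', hT'T, hs, hT', fun s hs α hα hαc => ?_⟩
    by_contra h
    exact hbad s hs ⟨α, hα, hαc, h⟩
  · exfalso
    have : Fact c.IsRegular := ⟨hc⟩
    have hR := hasCardinalLT_reachable (K := K) (T := T) hc hc' (countable_iterHull hM) F s₀
    -- Fewer than c reachable nodes with countable hulls contribute fewer than c ordinals. A bound
    -- `b` < c for them contradicts the play that exceeds `b`.
    have hU := hasCardinalLT_iUnion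
      (fun s : {s | Reachable K c (iterHull M) T F s₀ s} => {a | a < c.ord ∧ a.toZFSet ∈ iterHull M s})
      hR fun s => by
        have : Countable {a | a < c.ord ∧ a.toZFSet ∈ iterHull M s} :=
          (((countable_iterHull hM s.1).preimage toZFSet_injective).mono
            fun a ha => ha.2).to_subtype
        exact hasCardinalLT_of_countable hc'
    obtain ⟨b, hb, hbd⟩ := exists_toZFSet_bound hc hU (fun a => a.1) (by
      rintro ⟨a, ha⟩
      obtain ⟨s, hs⟩ := Set.mem_iUnion.1 ha
      exact hs.1)
    obtain ⟨s, hs, α, hα, hαc, hαb⟩ := hF ⟨b, hb⟩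
    obtain ⟨a, ha, rfl⟩ := mem_toZFSet_iff.1 hαc
    exact hαb (toZFSet_subset_toZFSet_iff.2
      (hbd ⟨a, Set.mem_iUnion.2 ⟨⟨s, hs⟩, ha, hα⟩⟩))

/-! ### Clubs of countable sets -/

theorem IsClubIn.inter {X : Set ZFSet.{u}} {C D : Set (Set ZFSet.{u})} (hC : IsClubIn X C)
    (hD : IsClubIn X D) : IsClubIn X (C ∩ D) where
  subset := fun _ ha => hC.subset ha.1
  unbounded := by
    intro a ha
    choose! f hf haf using hC.unbounded
    choose! g hg hag using hD.unbounded
    let x : ℕ → Set ZFSet.{u} := fun n => n.rec a fun _ y => g (f y)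
    have hx : ∀ n, x n ∈ countableSubsets X := by
      intro n
      induction n with
      | zero => exact ha
      | succ n ih => exact hD.subset (hg _ (hC.subset (hf _ ih)))
    have hxf : ∀ n, x n ⊆ f (x n) := fun n => haf _ (hx n)
    have hfx : ∀ n, f (x n) ⊆ x (n + 1) := fun n => hag _ (hC.subset (hf _ (hx n)))
    have hmono : Monotone x := monotone_nat_of_le_succ fun n => (hxf n).trans (hfx n)
    refine ⟨⋃ n, x n, ⟨?_, ?_⟩, Set.subset_iUnion x 0⟩
    · have : ⋃ n, x n = ⋃ n, f (x n) :=
        (Set.iUnion_mono hxf).antisymm (Set.iUnion_subset fun n =>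
          (hfx n).trans (Set.subset_iUnion x (n + 1)))
      rw [this]
      exact hC.closed _ (monotone_nat_of_le_succ fun n => (hfx n).trans (hxf (n + 1)))
        fun n => hf _ (hx n)
    · rw [← hmono.iUnion_nat_add 1]
      exact hD.closed _ (fun m n h => hmono (Nat.add_le_add_right h 1))
        fun n => hg _ (hC.subset (hf _ (hx n)))
  closed := fun c hc h => ⟨hC.closed c hc fun n => (h n).1, hD.closed c hc fun n => (h n).2⟩

theorem iUnion_mem_countableSubsets {X : Set ZFSet.{u}} {c : ℕ → Set ZFSet.{u}}
    (hc : ∀ n, c n ∈ countableSubsets X) : (⋃ n, c n) ∈ countableSubsets X :=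
  ⟨Set.iUnion_subset fun n => (hc n).1, Set.countable_iUnion fun n => (hc n).2.1,
    (hc 0).2.2.mono (Set.subset_iUnion c 0)⟩

/-- Clubs are closed under unions of countable chains. -/
theorem IsClubIn.iUnion_mem {X : Set ZFSet.{u}} {C : Set (Set ZFSet.{u})} (hC : IsClubIn X C)
    {ι : Type*} [LinearOrder ι] [Countable ι] [Nonempty ι] {c : ι → Set ZFSet.{u}}
    (hc : Monotone c) (h : ∀ i, c i ∈ C) : (⋃ i, c i) ∈ C := by
  obtain ⟨e, he⟩ := exists_surjective_nat ι
  -- Running maxima of an enumeration give an increasing cofinal sequence.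
  have : ⋃ i, c i = ⋃ n, c (partialSups e n) := by
    refine (Set.iUnion_subset fun i => ?_).antisymm (Set.iUnion_subset fun n =>
      Set.subset_iUnion c _)
    obtain ⟨n, rfl⟩ := he i
    exact (hc (le_partialSups e n)).trans (Set.subset_iUnion (fun n => c (partialSups e n)) n)
  rw [this]
  exact hC.closed _ (hc.comp (partialSups e).monotone) fun n => h _

theorem isClubIn_isConstClosed {θ : Cardinal.{u}} (hθ : θ.IsRegular) :
    IsClubIn (H θ) {M | M ∈ countableSubsets (H θ) ∧ IsConstClosed M} where
  subset := fun _ h => h.1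
  unbounded := by
    intro a ha
    let step : Set ZFSet.{u} → Set ZFSet.{u} := fun y =>
      y ∪ ⋃ n, Set.image2 (pointwiseConst n) y y
    let x : ℕ → Set ZFSet.{u} := fun n => n.rec a fun _ y => step y
    have hx : ∀ n, x n ∈ countableSubsets (H θ) := by
      intro n
      induction n with
      | zero => exact ha
      | succ n ih =>
        refine ⟨Set.union_subset ih.1 (Set.iUnion_subset fun m => ?_),
          ih.2.1.union (Set.countable_iUnion fun m => ih.2.1.image2 ih.2.1 _),
          ih.2.2.mono Set.subset_union_left⟩
        rintro _ ⟨y, hy, z, hz, rfl⟩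
        exact pointwiseConst_mem_H hθ m (ih.1 hy) (ih.1 hz)
    have hmono : Monotone x := monotone_nat_of_le_succ fun n => Set.subset_union_left
    refine ⟨⋃ n, x n, ⟨iUnion_mem_countableSubsets hx, ?_⟩, Set.subset_iUnion x 0⟩
    intro k y hy z hz
    obtain ⟨m, hm⟩ := Set.mem_iUnion.1 hy
    obtain ⟨n, hn⟩ := Set.mem_iUnion.1 hz
    exact Set.mem_iUnion.2 ⟨max m n + 1, .inr (Set.mem_iUnion.2 ⟨k,
      Set.mem_image2_of_mem (hmono (le_max_left m n) hm) (hmono (le_max_right m n) hn)⟩)⟩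
  closed := by
    intro c hmono hc
    refine ⟨iUnion_mem_countableSubsets fun n => (hc n).1, ?_⟩
    intro k y hy z hz
    obtain ⟨m, hm⟩ := Set.mem_iUnion.1 hy
    obtain ⟨n, hn⟩ := Set.mem_iUnion.1 hz
    exact Set.mem_iUnion.2 ⟨max m n, (hc _).2 k _ (hmono (le_max_left m n) hm) _
      (hmono (le_max_right m n) hn)⟩

/-! ### Skolem functions and elementary submodels -/

instance : Countable (Σ n, SetRel n) :=
  Function.Injective.countable (f := fun _ => ()) <| by
    rintro ⟨_, ⟨⟩⟩ ⟨_, ⟨⟩⟩ _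
    rfl

instance : IsEmpty (Σ n, setLang.Functions n) := ⟨fun f => Empty.elim f.2⟩

theorem countable_skolem_functions :
    Countable (Σ n, (setLang.sum setLang.skolem₁).Functions n) := by
  have h : Countable setLang.Symbols :=
    @instCountableSum _ _ _ (inferInstanceAs (Countable (Σ n, SetRel n)))
  rw [← Cardinal.mk_le_aleph0_iff]
  refine FirstOrder.Language.card_functions_sum_skolem₁_le.trans (max_le le_rfl ?_)
  exact Cardinal.mk_le_aleph0_iff.2 h

/-- `M` is closed under Skolem functions for the structure `A`. -/
def IsSkolemClosed (A : Set ZFSet.{u}) [Nonempty A] (M : Set ZFSet.{u}) : Prop :=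
  ∃ S : (setLang.sum setLang.skolem₁).Substructure A, Subtype.val '' (S : Set A) = M

theorem isClubIn_isSkolemClosed (A : Set ZFSet.{u}) [Nonempty A] :
    IsClubIn A {M | M ∈ countableSubsets A ∧ IsSkolemClosed A M} where
  subset := fun _ h => h.1
  unbounded := by
    intro a ha
    have := countable_skolem_functions
    let S := FirstOrder.Language.Substructure.closure (setLang.sum setLang.skolem₁)
      (Subtype.val ⁻¹' a : Set A)
    have hS : (S : Set A).Countable :=
      Set.Countable.substructure_closure _ (ha.2.1.preimage Subtype.val_injective)
    have haS : a ⊆ Subtype.val '' (S : Set A) := fun x hx =>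
      ⟨⟨x, ha.1 hx⟩, FirstOrder.Language.Substructure.subset_closure hx, rfl⟩
    refine ⟨_, ⟨⟨?_, hS.image _, ha.2.2.mono haS⟩, S, rfl⟩, haS⟩
    rintro _ ⟨x, -, rfl⟩
    exact x.2
  closed := by
    intro c hmono hc
    refine ⟨iUnion_mem_countableSubsets fun n => (hc n).1, ?_⟩
    choose S hS using fun n => (hc n).2
    refine ⟨⨆ n, S n, ?_⟩
    have hSm : Monotone S := by
      intro m n hmn x hx
      have := hmono hmn (hS m ▸ Set.mem_image_of_mem Subtype.val hx)
      rw [← hS n] at this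
      obtain ⟨y, hy, hyx⟩ := this
      exact Subtype.ext hyx ▸ hy
    ext x
    simp only [← hS, Set.mem_image, Set.mem_iUnion, SetLike.mem_coe,
      FirstOrder.Language.Substructure.mem_iSup_of_directed hSm.directed_le]
    constructor
    · rintro ⟨y, ⟨n, hn⟩, rfl⟩
      exact ⟨n, y, hn, rfl⟩
    · rintro ⟨n, y, hn, rfl⟩
      exact ⟨y, ⟨n, hn⟩, rfl⟩

/-- Closure under Skolem functions gives elementarity by the Tarski–Vaught test; `e` merely
identifies a subtype of `A` with its image among all sets. -/
theorem IsSkolemClosed.isElementarySubmodel {A : Set ZFSet.{u}} [Nonempty A] {M : Set ZFSet.{u}}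
    (hM : IsSkolemClosed A M) : IsElementarySubmodel M A := by
  obtain ⟨S, rfl⟩ := hM
  let e : (Subtype.val '' (S : Set A) : Set ZFSet.{u}) ≃[setLang] S.elementarySkolem₁Reduct :=
    { toFun := fun x => ⟨⟨x.1, by obtain ⟨y, -, hy⟩ := x.2; exact hy ▸ y.2⟩, by
        obtain ⟨_, y, hy, rfl⟩ := x
        exact hy⟩
      invFun := fun x => ⟨x.1.1, x.1, x.2, rfl⟩
      left_inv := fun _ => rfl
      right_inv := fun _ => rfl
      map_fun' := fun f => Empty.elim f
      map_rel' := fun r _ => by cases r; exact Iff.rfl }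
  exact ⟨S.elementarySkolem₁Reduct.subtype.comp e.toElementaryEmbedding, fun _ => rfl⟩

theorem natCast_toZFSet_mem_H {θ : Cardinal.{u}} (hθ : θ.IsRegular) (n : ℕ) :
    (n : Ordinal.{u}).toZFSet ∈ H θ :=
  toZFSet_mem_H (by simpa using hθ.nat_lt n)

theorem infinite_range_natCast_toZFSet :
    (Set.range fun n : ℕ => (n : Ordinal.{u}).toZFSet).Infinite :=
  Set.infinite_range_of_injective (toZFSet_injective.comp Nat.cast_injective)

theorem IsElementarySubmodel.infinite {A M : Set ZFSet.{u}} (h : IsElementarySubmodel M A)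
    (hA : A.Infinite) : M.Infinite := by
  obtain ⟨e, -⟩ := h
  exact Set.infinite_coe_iff.1 (e.elementarilyEquivalent.infinite_iff.2 hA.to_subtype)

theorem IsElementarySubmodel.subset {A M : Set ZFSet.{u}} (h : IsElementarySubmodel M A) :
    M ⊆ A := by
  obtain ⟨e, he⟩ := h
  intro x hx
  have := (e ⟨x, hx⟩).2
  rwa [he] at this

/-! ### Chains of models of length `ω₁` -/

/-- Stage `i` contains `i`, so the union of the stages below δ contains δ. Continuity is not
required, since only these unions serve as models later. -/
theorem IsClubIn.exists_chain {θ : Cardinal.{u}} (hθ : θ.IsRegular) (hθ' : ℵ₀ < θ)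
    {C : Set (Set ZFSet.{u})} (hC : IsClubIn (H θ) C) {p : ZFSet.{u}} (hp : p ∈ H θ) :
    ∃ M : Ordinal.{u} → Set ZFSet.{u}, ∀ i < ω₁, M i ∈ C ∧ p ∈ M i ∧ i.toZFSet ∈ M i ∧
      ∀ j < i, M j ⊆ M i := by
  choose! f hf haf using hC.unbounded
  let pre : (i : Ordinal.{u}) → ((j : Ordinal.{u}) → j < i → Set ZFSet.{u}) → Set ZFSet.{u} :=
    -- The natural numbers make the set infinite already at stage 0, as membership in `[X]^ω`
    -- demands.
    fun i g => (Set.range fun n : ℕ => (n : Ordinal.{u}).toZFSet) ∪ {p, i.toZFSet} ∪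
      ⋃ j : Set.Iio i, g j.1 j.2
  let M : Ordinal.{u} → Set ZFSet.{u} := WellFoundedLT.fix fun i g => f (pre i g)
  have hM : ∀ i, M i = f (pre i fun j _ => M j) := fun i => WellFoundedLT.fix_eq _ _
  have hpre : ∀ i < ω₁, (pre i fun j _ => M j) ∈ countableSubsets (H θ) := by
    intro i
    induction i using WellFoundedLT.induction with
    | ind i ih =>
      intro hi
      have hi' : i.card ≤ ℵ₀ := by
        rw [← Order.lt_succ_iff, succ_aleph0, ← lt_ord, ord_aleph]
        exact hi
      have : Countable (Set.Iio i) := by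
        rw [← Cardinal.mk_le_aleph0_iff, Cardinal.mk_Iio_ordinal, Cardinal.lift_le_aleph0]
        exact hi'
      have hj : ∀ j : Set.Iio i, M j.1 ∈ countableSubsets (H θ) := fun j => by
        rw [hM]
        exact hC.subset (hf _ (ih j.1 j.2 (j.2.trans hi)))
      refine ⟨Set.union_subset (Set.union_subset ?_ ?_) (Set.iUnion_subset fun j => (hj j).1),
        ((Set.countable_range _).union (Set.to_countable _)).union
          (Set.countable_iUnion fun j => (hj j).2.1),
        infinite_range_natCast_toZFSet.mono
          (Set.subset_union_left.trans Set.subset_union_left)⟩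
      · rintro _ ⟨n, rfl⟩
        exact natCast_toZFSet_mem_H hθ n
      · rintro _ (rfl | rfl)
        exacts [hp, toZFSet_mem_H (hi'.trans_lt hθ')]
  refine ⟨M, fun i hi => ?_⟩
  have hsub : (pre i fun j _ => M j) ⊆ M i := by
    have := haf _ (hpre i hi)
    rwa [← hM] at this
  refine ⟨?_, hsub (.inl (.inr (by simp))), hsub (.inl (.inr (by simp))), fun j hj =>
    subset_trans ?_ hsub⟩
  · rw [hM]
    exact hf _ (hpre i hi)
  · exact (Set.subset_iUnion (fun j : Set.Iio i => M j.1) ⟨j, hj⟩).trans Set.subset_union_right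

theorem isClub_closurePoints {g : Ordinal.{u} → Ordinal.{u}} (hg : ∀ i < ω₁, g i < ω₁) :
    IsClub {δ : Set.Iio (ω₁ : Ordinal.{u}) | 0 < δ.1 ∧ ∀ i < δ.1, g i ≤ δ.1} where
  dirSupClosed := by
    intro t ht hne _ δ hδ
    obtain ⟨ε, hε⟩ := hne
    refine ⟨(ht hε).1.trans_le (hδ.1 hε), fun i hi => ?_⟩
    obtain ⟨η, hη, hiη⟩ := (lt_isLUB_iff hδ (b := ⟨i, hi.trans δ.2⟩)).1 hi
    exact ((ht hη).2 i hiη).trans (hδ.1 hη)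
  isCofinal := by
    have hb : ∀ x : Ordinal.{u}, ∃ y, x < ω₁ → x < y ∧ y < ω₁ ∧ ∀ i < x, g i ≤ y := by
      intro x
      by_cases hx : x < ω₁
      swap
      · exact ⟨0, fun h => absurd h hx⟩
      have hx' : x < (ℵ₁).ord := by rwa [ord_aleph]
      obtain ⟨y, hy, hgy⟩ := exists_toZFSet_bound isRegular_aleph_one (X := Set.Iio x) (by
        rw [HasCardinalLT, Cardinal.mk_Iio_ordinal, Cardinal.lift_lift]
        exact Cardinal.lift_lt.2 (lt_ord.1 hx')) (fun i => g i.1)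
        (fun i => by rw [ord_aleph]; exact hg _ (i.2.trans hx))
      rw [ord_aleph] at hy
      refine ⟨max (Order.succ x) y, fun _ => ⟨?_, ?_, fun i hi => ?_⟩⟩
      · exact (Order.lt_succ x).trans_le (le_max_left _ _)
      · exact max_lt ((isSuccLimit_omega 1).succ_lt hx) hy
      · exact (hgy ⟨i, hi⟩).trans (le_max_right _ _)
    choose b hb using hb
    rintro ⟨a, ha⟩
    let x : ℕ → Ordinal.{u} := fun n => n.rec a fun _ y => b y
    have hx : ∀ n, x n < ω₁ := by
      intro n
      induction n with
      | zero => exact ha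
      | succ n ih => exact (hb _ ih).2.1
    have hsup : ⨆ n, x n < ω₁ := Ordinal.iSup_lt_omega_one hx
    have hle : ∀ n, x n ≤ ⨆ n, x n := fun n => Ordinal.le_iSup x n
    refine ⟨⟨⨆ n, x n, hsup⟩, ⟨?_, fun i hi => ?_⟩, hle 0⟩
    · exact zero_le.trans_lt ((hb _ (hx 0)).1.trans_le (hle 1))
    · obtain ⟨n, hn⟩ := Ordinal.lt_iSup_iff.1 hi
      exact ((hb _ (hx n)).2.2 i hn).trans (hle (n + 1))

/-- A play is finite, so the finitely many memberships that make its moves legal all hold from some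
stage on. -/
theorem exists_reachable_of_iUnion {K : ZFSet.{u}} {μ : Cardinal.{u}} {T : Set (List ZFSet.{u})}
    {F : List ZFSet.{u} → ZFSet.{u} → ZFSet.{u}} {s₀ : List ZFSet.{u}} {ι : Type*} [LinearOrder ι]
    [Nonempty ι] {D : ι → Set ZFSet.{u}} (hD : Monotone D) {s : List ZFSet.{u}}
    (hs : Reachable K μ (iterHull (⋃ i, D i)) T F s₀ s) :
    ∃ i, ∀ j, i ≤ j → Reachable K μ (iterHull (D j)) T F s₀ s := by
  induction hs with
  | root => exact ⟨Classical.arbitrary ι, fun _ _ => .root⟩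
  | small _ hκ hκA hκμ hξ hξT ih =>
    obtain ⟨i, hi⟩ := ih
    obtain ⟨k, hk⟩ := exists_mem_iterHull_of_mem_iUnion hκA
    exact ⟨max i k, fun j hj => .small (hi j ((le_max_left i k).trans hj)) hκ
      (iterHull_mono (hD ((le_max_right i k).trans hj)) _ hk) hκμ hξ hξT⟩
  | large _ hκ hκA hκμ ih =>
    obtain ⟨i, hi⟩ := ih
    obtain ⟨k, hk⟩ := exists_mem_iterHull_of_mem_iUnion hκA
    exact ⟨max i k, fun j hj => .large (hi j ((le_max_left i k).trans hj)) hκ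
      (iterHull_mono (hD ((le_max_right i k).trans hj)) _ hk) hκμ⟩

theorem ord_aleph_one_toZFSet : (ℵ₁ : Cardinal.{u}).ord.toZFSet = omegaOne := by
  rw [ord_aleph, omegaOne]

/-- In a continuous chain of countable models, there are stationarily many models that carry a
Namba tree along which no countable ordinals are added. -/
theorem exists_isNambaTree_of_chain {K : ZFSet.{u}} (hK : ∀ κ ∈ K, IsUncountableRegular κ)
    (hω₁ : omegaOne ∉ K) {M : Ordinal.{u} → Set ZFSet.{u}} (hM : ∀ i < ω₁, (M i).Countable)
    (hmono : ∀ i < ω₁, ∀ j < i, M j ⊆ M i) {S : Set (Set.Iio (ω₁ : Ordinal.{u}))}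
    (hS : IsStationary S) :
    ∃ δ ∈ S, 0 < δ.1 ∧ ∃ T : Set (List ZFSet.{u}), [] ∈ T ∧
      IsNambaTree K (iterHull (⋃ j : Set.Iio δ.1, M j.1)) T ∧
      ∀ s ∈ T, ∀ α ∈ iterHull (⋃ j : Set.Iio δ.1, M j.1) s, α ∈ omegaOne → α ∈ δ.1.toZFSet := by
  have hK' : ∀ κ ∈ K, ∃ d : Cardinal.{u}, d.IsRegular ∧ κ = d.ord.toZFSet ∧ d ≠ ℵ₁ := by
    intro κ hκ
    obtain ⟨d, -, hd, rfl⟩ := hK κ hκ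
    exact ⟨d, hd, rfl, by rintro rfl; exact hω₁ (ord_aleph_one_toZFSet ▸ hκ)⟩
  have hD : ∀ δ : Set.Iio (ω₁ : Ordinal.{u}), Monotone fun j : Set.Iio δ.1 => M j.1 := by
    intro δ j k hjk
    rcases hjk.eq_or_lt with rfl | hjk
    exacts [subset_rfl, hmono k.1 (k.2.trans δ.2) j.1 hjk]
  have hB : HasCardinalLT {δ : Set.Iio (ω₁ : Ordinal.{u}) | δ ∈ S ∧ 0 < δ.1} (Order.succ ℵ₁) := by
    have := hasCardinalLT_Iio_ord ℵ₁
    rw [ord_aleph] at this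
    exact this.of_injective _ Subtype.val_injective
  rcases exists_isNambaTree_or_reachable hB hK' (T := Set.univ)
    (A := fun δ => iterHull (⋃ j : Set.Iio δ.1.1, M j.1))
    -- In the tree of all sequences ν itself is an answer outside ν.
    (fun _ _ _ _ _ _ ν hν => ⟨ν, hν, ZFSet.mem_irrefl ν, trivial⟩)
    (fun δ s => ∃ α ∈ iterHull (⋃ j : Set.Iio δ.1.1, M j.1) s, α ∈ omegaOne ∧ α ∉ δ.1.1.toZFSet)
    (s₀ := []) trivial with ⟨δ, T, -, h0, hT, hbad⟩ | ⟨F, hF⟩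
  · refine ⟨δ.1, δ.2.1, δ.2.2, T, h0, hT, fun s hs α hα hα₁ => ?_⟩
    by_contra h
    exact hbad s hs ⟨α, hα, hα₁, h⟩
  · exfalso
    -- One `F` serves all δ, so this bound depends on the stage `i` only.
    have hg : ∀ i, ∃ b, i < ω₁ → b < ω₁ ∧ ∀ s, Reachable K ℵ₁ (iterHull (M i)) Set.univ F [] s →
        ∀ a < ω₁, a.toZFSet ∈ iterHull (M i) s → a < b := by
      intro i
      by_cases hi : i < ω₁
      swap
      · exact ⟨0, fun h => absurd h hi⟩
      have hR : {s | Reachable K ℵ₁ (iterHull (M i)) Set.univ F [] s}.Countable := by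
        have := hasCardinalLT_reachable (K := K) (T := Set.univ) isRegular_aleph_one
          aleph0_lt_aleph_one (countable_iterHull (hM i hi)) F []
        rw [HasCardinalLT, Cardinal.lift_aleph] at this
        rw [← Cardinal.le_aleph0_iff_set_countable, ← Order.lt_succ_iff, succ_aleph0]
        simpa using this
      have hU : {a | a < ω₁ ∧ ∃ s, Reachable K ℵ₁ (iterHull (M i)) Set.univ F [] s ∧
          a.toZFSet ∈ iterHull (M i) s}.Countable := by
        refine (hR.biUnion fun s _ => ((countable_iterHull (hM i hi) s).preimage
          toZFSet_injective)).mono ?_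
        rintro a ⟨-, s, hs, ha⟩
        exact Set.mem_biUnion hs ha
      have := hU.to_subtype
      obtain ⟨b, hb, hab⟩ := exists_toZFSet_bound isRegular_aleph_one
        (hasCardinalLT_of_countable aleph0_lt_aleph_one (X := {a | a < ω₁ ∧ ∃ s,
          Reachable K ℵ₁ (iterHull (M i)) Set.univ F [] s ∧ a.toZFSet ∈ iterHull (M i) s}))
        (fun a => a.1) (fun a => by rw [ord_aleph]; exact a.2.1)
      rw [ord_aleph] at hb
      -- The successor makes the bound strict, so that `g i ≤ δ` is enough at closure points.
      exact ⟨Order.succ b, fun _ => ⟨(isSuccLimit_omega 1).succ_lt hb, fun s hs a ha has =>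
        Order.lt_succ_of_le (hab ⟨a, ha, s, hs, has⟩)⟩⟩
    choose g hg using hg
    obtain ⟨δ, hδS, hδ0, hδ⟩ := hS (isClub_closurePoints fun i hi => (hg i hi).1)
    obtain ⟨s, hs, α, hα, hα₁, hαδ⟩ := hF ⟨δ, hδS, hδ0⟩
    obtain ⟨a, ha, rfl⟩ := mem_toZFSet_iff.1 hα₁
    have : Nonempty (Set.Iio δ.1) := ⟨⟨0, hδ0⟩⟩
    -- The bad play for δ and its witness already occur over some `M j` with j < δ, which puts the
    -- witness below `g j ≤ δ`.
    obtain ⟨i, hi⟩ := exists_reachable_of_iUnion (hD δ) hs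
    obtain ⟨k, hk⟩ := exists_mem_iterHull_of_mem_iUnion hα
    let j := max i k
    have hj : j.1 < ω₁ := j.2.trans δ.2
    refine hαδ (toZFSet_mem_toZFSet_iff.2 (lt_of_lt_of_le ?_ (hδ j.1 j.2)))
    exact (hg j.1 hj).2 s (hi j (le_max_left i k)) a ha
      (iterHull_mono (hD δ (le_max_right i k)) s hk)

/-! ### The strategy -/

section Strategy

variable {K : ZFSet.{u}} {M : Set ZFSet.{u}}

/-- The conclusion of `IsNambaTree.exists_bounded`. -/
def IsBoundedSubtree (K : ZFSet.{u}) (M : Set ZFSet.{u}) (s : List ZFSet.{u}) (l : ZFSet.{u})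
    (T : Set (List ZFSet.{u})) (p : ZFSet.{u} × Set (List ZFSet.{u})) : Prop :=
  p.1 ∈ l ∧ p.2 ⊆ T ∧ s ∈ p.2 ∧ IsNambaTree K (iterHull M) p.2 ∧
    ∀ t ∈ p.2, ∀ α ∈ iterHull M t, α ∈ l → α ⊆ p.1

/-- A bound below `l` and a subtree of `T` through `s` in which it is respected. -/
noncomputable def shrinkTree (K : ZFSet.{u}) (M : Set ZFSet.{u}) (s : List ZFSet.{u})
    (l : ZFSet.{u}) (T : Set (List ZFSet.{u})) : ZFSet.{u} × Set (List ZFSet.{u}) :=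
  Classical.epsilon (IsBoundedSubtree K M s l T)

/-- The tree in which the second player answers after the rounds `h`. -/
noncomputable def currentTree (K : ZFSet.{u}) (M : Set ZFSet.{u}) (T : Set (List ZFSet.{u})) :
    List Round.{u} → Set (List ZFSet.{u})
  | [] => T
  | r :: h => match r.promise with
    | none => currentTree K M T h
    | some p => (shrinkTree K M (h.map Round.xi) p.1 (currentTree K M T h)).2

/-- The strategy for the second player given by a Namba tree: shrink the tree to bound the models
below `l`, and choose the answer in the tree. -/
noncomputable def treeStrategy (K : ZFSet.{u}) (M : Set ZFSet.{u}) (T : Set (List ZFSet.{u})) :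
    Strategy.{u} where
  bound h l := (shrinkTree K M (h.map Round.xi) l (currentTree K M T h)).1
  -- The current tree does not depend on the latest answer, so `∅` stands in for the answer being
  -- chosen.
  answer h p κ ν := Classical.epsilon fun ξ => ξ ∈ κ ∧ ξ ∉ ν ∧
    ξ :: h.map Round.xi ∈ currentTree K M T (⟨p, κ, ν, ∅⟩ :: h)

/-- What the second player maintains when following `treeStrategy`. -/
structure TreeInvariant (K : ZFSet.{u}) (M : Set ZFSet.{u}) (T U : Set (List ZFSet.{u}))
    (P : Set (ZFSet.{u} × ZFSet.{u})) (s : List ZFSet.{u}) : Prop where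
  subset : U ⊆ T
  mem : s ∈ U
  tree : IsNambaTree K (iterHull M) U
  bounded : ∀ l β, (l, β) ∈ P → ∀ t ∈ U, ∀ α ∈ iterHull M t, α ∈ l → α ⊆ β

theorem promises_cons_none {h : List Round.{u}} {κ ν ξ : ZFSet.{u}} :
    promises (⟨none, κ, ν, ξ⟩ :: h) = promises h := by
  simp [promises]

theorem promises_cons_some {h : List Round.{u}} {p : ZFSet.{u} × ZFSet.{u}} {κ ν ξ : ZFSet.{u}} :
    promises (⟨some p, κ, ν, ξ⟩ :: h) = insert p (promises h) := by
  ext q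
  simp [promises, eq_comm]

theorem isBoundedSubtree_shrinkTree (hK : ∀ κ ∈ K, IsUncountableRegular κ) (hM : M.Countable)
    {T U : Set (List ZFSet.{u})} {P : Set (ZFSet.{u} × ZFSet.{u})} {s : List ZFSet.{u}}
    (hinv : TreeInvariant K M T U P s) {N : Set ZFSet.{u}} {l : ZFSet.{u}}
    (hl : LegalCardinal K N l) : IsBoundedSubtree K M s l U (shrinkTree K M s l U) := by
  obtain ⟨⟨c, hc, rfl⟩, -, hl₁, -, hlK⟩ := hl
  refine Classical.epsilon_spec (p := IsBoundedSubtree K M s c.ord.toZFSet U) ?_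
  have hc' : ℵ₀ < c := by
    rw [← ord_aleph_one_toZFSet, toZFSet_mem_toZFSet_iff, ord_lt_ord] at hl₁
    exact aleph0_lt_aleph_one.trans hl₁
  obtain ⟨β, hβ, T', h⟩ := hinv.tree.exists_bounded hK hM hinv.mem hc hc' hlK
  exact ⟨(β, T'), hβ, h⟩

/-- Shrinking the tree for the first half of a round preserves the invariant. -/
theorem TreeInvariant.promise (hK : ∀ κ ∈ K, IsUncountableRegular κ) (hM : M.Countable)
    {T : Set (List ZFSet.{u})} {h : List Round.{u}}
    (hinv : TreeInvariant K M T (currentTree K M T h) (promises h) (h.map Round.xi))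
    {N : Set ZFSet.{u}} {l? : Option ZFSet.{u}} (hl : LegalFirst K N l?) (κ ν ξ : ZFSet.{u}) :
    TreeInvariant K M T
      (currentTree K M T (⟨l?.map fun l => (l, (treeStrategy K M T).bound h l), κ, ν, ξ⟩ :: h))
      (promises (⟨l?.map fun l => (l, (treeStrategy K M T).bound h l), κ, ν, ξ⟩ :: h))
      (h.map Round.xi) := by
  cases l? with
  | none =>
    rw [Option.map_none, promises_cons_none]
    exact hinv
  | some l =>
    rw [Option.map_some, promises_cons_some]
    obtain ⟨-, hsub, hmem, htree, hbd⟩ := isBoundedSubtree_shrinkTree hK hM hinv hl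
    refine ⟨hsub.trans hinv.subset, hmem, htree, ?_⟩
    rintro l' β (h' | h') t ht
    · obtain ⟨rfl, rfl⟩ := Prod.mk.inj h'
      exact hbd t ht
    · exact hinv.bounded l' β h' t (hsub ht)

/-- The shrunken tree still passes through the current position, so its splitting there supplies the
answer. Promises are kept at every node of the tree, in particular at the new one. -/
theorem treeStrategy_answer (hK : ∀ κ ∈ K, IsUncountableRegular κ) (hM : M.Countable)
    {T : Set (List ZFSet.{u})} {h : List Round.{u}}
    (hinv : TreeInvariant K M T (currentTree K M T h) (promises h) (h.map Round.xi))
    {l? : Option ZFSet.{u}} {κ ν : ZFSet.{u}} (hl : LegalFirst K (model M h) l?)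
    (hκ : LegalSecond K (model M h) κ ν) :
    ((treeStrategy K M T).round h l? κ ν).xi ∈ κ ∧ ((treeStrategy K M T).round h l? κ ν).xi ∉ ν ∧
    TreeInvariant K M T (currentTree K M T ((treeStrategy K M T).round h l? κ ν :: h))
      (promises ((treeStrategy K M T).round h l? κ ν :: h))
      (((treeStrategy K M T).round h l? κ ν :: h).map Round.xi) := by
  let p := l?.map fun l => (l, (treeStrategy K M T).bound h l)
  have hinv' := hinv.promise hK hM hl κ ν ∅
  have hex := hinv'.tree _ hinv'.mem κ hκ.1 (by rw [← model_eq_iterHull]; exact hκ.2.1) ν hκ.2.2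
  obtain ⟨h1, h2, h3⟩ := Classical.epsilon_spec (p := fun ξ => ξ ∈ κ ∧ ξ ∉ ν ∧
    ξ :: h.map Round.xi ∈ currentTree K M T (⟨p, κ, ν, ∅⟩ :: h)) hex
  have hinv'' := hinv.promise hK hM hl κ ν ((treeStrategy K M T).round h l? κ ν).xi
  exact ⟨h1, h2, hinv''.subset, h3, hinv''.tree, hinv''.bounded⟩

theorem treeStrategy_isRun (hK : ∀ κ ∈ K, IsUncountableRegular κ) (hM : M.Countable)
    (hM' : IsConstClosed M) {T : Set (List ZFSet.{u})} (hT : IsNambaTree K (iterHull M) T)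
    (hT0 : [] ∈ T) {h : List Round.{u}} (hrun : IsRun M K (treeStrategy K M T) h) :
    TreeInvariant K M T (currentTree K M T h) (promises h) (h.map Round.xi) ∧
      IsConstClosed (model M h) ∧ M ⊆ model M h := by
  induction hrun with
  | start =>
    refine ⟨⟨subset_rfl, hT0, hT, ?_⟩, hM', subset_rfl⟩
    rintro l β ⟨r, hr, -⟩
    simp at hr
  | step h l? κ ν _ hfirst hsecond ih =>
    obtain ⟨hinv, hcl, hsub⟩ := ih
    obtain ⟨h1, -, h3⟩ := treeStrategy_answer hK hM hinv hfirst hsecond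
    exact ⟨h3, hcl.hull _, hsub.trans (hcl.subset_hull hsecond.2.1 h1)⟩

/-- If a Namba tree adds no countable ordinals to `M`, then the second player wins. -/
theorem treeStrategy_isWinning (hK : ∀ κ ∈ K, IsUncountableRegular κ) (hM : M.Countable)
    (hM' : IsConstClosed M) {T : Set (List ZFSet.{u})} (hT : IsNambaTree K (iterHull M) T)
    (hT0 : [] ∈ T) (hω : ∀ s ∈ T, ∀ α ∈ iterHull M s, α ∈ omegaOne → α ∈ M) :
    (treeStrategy K M T).IsWinning M K := by
  intro h hrun
  obtain ⟨hinv, hcl, hsub⟩ := treeStrategy_isRun hK hM hM' hT hT0 hrun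
  refine ⟨fun l hl => (isBoundedSubtree_shrinkTree hK hM hinv hl).1, ?_⟩
  intro l? κ ν hfirst hsecond
  obtain ⟨h1, h2, h3⟩ := treeStrategy_answer hK hM hinv hfirst hsecond
  have heq : hull (model M h) ((treeStrategy K M T).round h l? κ ν).xi =
      iterHull M (((treeStrategy K M T).round h l? κ ν :: h).map Round.xi) :=
    model_eq_iterHull M ((treeStrategy K M T).round h l? κ ν :: h)
  refine ⟨h1, h2, Set.Subset.antisymm ?_ ?_, fun l β hlβ α hα hαl => ?_⟩
  · rintro α ⟨hα, hα₁⟩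
    rw [heq] at hα
    exact ⟨hsub (hω _ (h3.subset h3.mem) α hα hα₁), hα₁⟩
  · exact Set.inter_subset_inter_left _ (hcl.subset_hull hsecond.2.1 h1)
  · rw [heq] at hα
    exact h3.bounded l β hlβ _ h3.mem α hα hαl

end Strategy

/-! ### Projective stationarity -/

theorem winningModels_subset {θ : Cardinal.{u}} (hθ : θ.IsRegular) (K : ZFSet.{u}) :
    winningModels θ K ⊆ countableSubsets (H θ) := by
  rintro M ⟨hM, hel, -⟩
  refine ⟨hel.subset, hM, hel.infinite (infinite_range_natCast_toZFSet.mono ?_)⟩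
  rintro _ ⟨n, rfl⟩
  exact natCast_toZFSet_mem_H hθ n

theorem isProjectiveStationary_winningModels {θ : Cardinal.{u}} (hθ : θ.IsRegular) (hθ' : ℵ₀ < θ)
    {K : ZFSet.{u}} (hKθ : K ∈ H θ) (hK : ∀ κ ∈ K, IsUncountableRegular κ)
    (hω₁ : omegaOne ∉ K) : IsProjectiveStationary (H θ) (winningModels θ K) := by
  refine ⟨winningModels_subset hθ K, fun S hS =>
    ⟨fun M hM => winningModels_subset hθ K hM.1, fun C hC => ?_⟩⟩
  have : Nonempty (H θ) := ⟨⟨∅, empty_mem_H hθ⟩⟩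
  have hC' := hC.inter ((isClubIn_isConstClosed hθ).inter (isClubIn_isSkolemClosed (H θ)))
  obtain ⟨M, hM⟩ := hC'.exists_chain hθ hθ' (sUnion_mem_H hKθ)
  obtain ⟨δ, hδS, hδ0, T, hT0, hT, hTω⟩ := exists_isNambaTree_of_chain hK hω₁
    (fun i hi => (hC'.subset (hM i hi).1).2.1) (fun i hi => (hM i hi).2.2.2) hS
  set D : Set ZFSet.{u} := ⋃ j : Set.Iio δ.1, M j.1
  have hδ : ∀ j : Set.Iio δ.1, j.1 < ω₁ := fun j => j.2.trans δ.2
  have hDC : D ∈ C ∩ ({M | M ∈ countableSubsets (H θ) ∧ IsConstClosed M} ∩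
      {M | M ∈ countableSubsets (H θ) ∧ IsSkolemClosed (H θ) M}) := by
    have : Nonempty (Set.Iio δ.1) := ⟨⟨0, hδ0⟩⟩
    have : Countable (Set.Iio δ.1) := by
      rw [← Cardinal.mk_le_aleph0_iff, Cardinal.mk_Iio_ordinal, Cardinal.lift_le_aleph0,
        ← Order.lt_succ_iff, succ_aleph0, ← lt_ord, ord_aleph]
      exact δ.2
    refine hC'.iUnion_mem (fun j k hjk => ?_) fun j => (hM j.1 (hδ j)).1
    rcases hjk.eq_or_lt with rfl | hjk
    exacts [subset_rfl, (hM k.1 (hδ k)).2.2.2 j.1 hjk]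
  obtain ⟨hDC, ⟨hDc, hDcl⟩, -, hDs⟩ := hDC
  have hδD : (δ.1.toZFSet : Set ZFSet.{u}) ⊆ D := by
    intro x hx
    obtain ⟨a, ha, rfl⟩ := mem_toZFSet_iff.1 hx
    exact Set.mem_iUnion.2 ⟨⟨a, ha⟩, (hM a (ha.trans δ.2)).2.2.1⟩
  refine ⟨D, ⟨⟨hDc.2.1, hDs.isElementarySubmodel,
    Set.mem_iUnion.2 ⟨⟨0, hδ0⟩, (hM 0 (hδ ⟨0, hδ0⟩)).2.1⟩, treeStrategy K D T,
    treeStrategy_isWinning hK hDc.2.1 hDcl hT hT0 fun s hs α hα hα₁ =>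
      hδD (hTω s hs α hα hα₁)⟩, δ, hδS, Set.Subset.antisymm ?_ fun x hx => ⟨hδD hx, ?_⟩⟩, hDC⟩
  -- At the root the hull is `D` itself, so the tree condition there bounds the trace of `D` by δ.
  · rintro x ⟨hx, hx₁⟩
    exact hTω [] hT0 x hx hx₁
  · obtain ⟨a, ha, rfl⟩ := mem_toZFSet_iff.1 hx
    exact toZFSet_mem_toZFSet_iff.2 (ha.trans δ.2)

end NambaGame

theorem mainTheorem4 (θ : Cardinal.{u}) (hθ : θ.IsRegular) (hθ' : Cardinal.aleph0 < θ)
    (K : ZFSet.{u}) (hKθ : K ∈ NambaGame.H θ)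
    (hlam : NambaGame.MuchSmaller (ZFSet.sUnion K) θ)
    (hK : ∀ κ ∈ K, NambaGame.IsUncountableRegular κ)
    (hω₁ : NambaGame.omegaOne ∉ K) :
    NambaGame.IsProjectiveStationary (NambaGame.H θ) (NambaGame.winningModels θ K) := by
  exact NambaGame.isProjectiveStationary_winningModels hθ hθ' hKθ hK hω₁
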